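/- **Setting.** Let $G=(V,E)$ be a finite digraph and $S,R\subseteq V$ (sources and terminals), $|R|=n$, and let $\succ$ be a total order on $R$. The gammoid $\Gamma(G,S,R)$ has ground set $R$; a set $X\subseteq R$ is independent if there are pairwise node-disjoint directed paths starting in $S$ and ending at the elements of $X$. For $Q\subseteq R$, $\mathrm{OPT}(Q)$ is the output of the greedy algorithm run on $Q$ in decreasing order, and $\mathrm{OPT}=\mathrm{OPT}(R)$. For every linked set $X$ fix a canonical collection $\mathcal P_X$ of node-disjoint $S$-$X$ paths, depending only on the subgraph formed by all arcs on $S$-$X$ paths (and the sources in it); for $x \in X$, $\mathcal P_X(x)$ is its path ending at $x$. The *exchangeability* of the presentation is the maximum, over independent sets $X$ and directed paths $Q$ from $S$ to a terminal outside $X$, of the number of paths of $\mathcal P_X$ that $Q$ intersects (and $0$ if there is no such pair). Terminals arrive in uniformly random order $r_1,\dots,r_n$; $R_i=\{r_1,\dots,r_i\}$. At step $i$ the algorithm knows $n$, the sequence $r_1,\dots,r_i$, the relative order of these terminals, the arcs lying on $S$-$R_i$ paths, and which vertices on these paths are sources. **Path-based algorithm** (sampling probability $p$). Draw $s\sim\mathrm{Bin}(n,p)$,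 independently of the arrival order; put $\mathrm{ALG}=\emptyset$, $\mathcal P=\emptyset$. For $i=s+1,\dots,n$: if $r_i\in\mathrm{OPT}(R_i)$ and no vertex of $\mathcal P_{\mathrm{OPT}(R_i)}(r_i)$ lies on a path of $\mathcal P$, add $r_i$ to $\mathrm{ALG}$ and this path to $\mathcal P$. Return $\mathrm{ALG}$. An algorithm *has forbidden sets of size $k$* if (i) it returns an independent set; (ii) it draws $s\sim \mathrm{Bin}(n,p)$ for a fixed $p$ and selects none of $r_1,\dots,r_s$; (iii) for all $Y\subseteq R$, $r^*\in\mathrm{OPT}(Y)$, $X\subseteq Y\setminus\{r^*\}$ there is a set $\mathcal F(X,Y,r^*)\subseteq X$ of at most $k$ elements such that, for every $t\ge s+1$, if $r_t\in\mathrm{OPT}(R_t)$ and $r_j\notin\mathcal F(R_j,R_t,r_t)$ for all $s<j<t$, then $r_t$ is selected. It is *$\alpha$ probability-competitive* ($\alpha\ge1$) if $\Pr(e\in \mathrm{ALG})\ge 1/\alpha$ for every $e\in\mathrm{OPT}$. Let $(p(1),\alpha(1))=(1/e,e)$ and $(p(k),\alpha(k))=(k^{-1/(k-1)},k^{k/(k-1)})$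 for integers $k\ge2$. **Theorem.** For every $p\in[0,1]$, the path-based algorithm has forbidden sets of size equal to the exchangeability of the presentation. For every integer $\mu\ge1$ that is at least the exchangeability (in particular for the exchangeability itself, if it is positive), the algorithm with $p=p(\mu)$ is $\alpha(\mu)$ probability-competitive. The algorithm is online: its decisions in the first $i$ steps depend only on $s$ and on what has been revealed up to step $i$. For $\mu\ge2$, $\alpha(\mu)=\mu^{\mu/(\mu-1)}<e\mu$. -/

import Mathlib

noncomputable section

/-- `IsPathTo G S v P`: the list `P` is the vertex sequence of a directed (simple) path of `G`
starting at a source (an element of `S`) and ending at `v`. The one-vertex path is allowed. -/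
def IsPathTo {V : Type*} (G : Digraph V) (S : Set V) (v : V) (P : List V) : Prop :=
  P.IsChain G.Adj ∧ P.Nodup ∧ (∃ u ∈ S, P.head? = some u) ∧ P.getLast? = some v

/-- `P` assigns to the elements `x ∈ X` pairwise node-disjoint directed `S`-`x` paths `P x`. -/
def IsLinking {V : Type*} (G : Digraph V) (S : Set V) (X : Finset V) (P : V → List V) : Prop :=
  (∀ x ∈ X, IsPathTo G S x (P x)) ∧
    ∀ x ∈ X, ∀ y ∈ X, x ≠ y → (P x).Disjoint (P y)

/-- `X` is linked to `S` in `G`. -/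
def Linked {V : Type*} (G : Digraph V) (S : Set V) (X : Finset V) : Prop :=
  ∃ P : V → List V, IsLinking G S X P

/-- The subgraph of `G` containing exactly the arcs lying on some `S`-`Y` path. -/
def revealedGraph {V : Type*} (G : Digraph V) (S : Set V) (Y : Finset V) : Digraph V where
  Adj u v := ∃ y ∈ Y, ∃ P : List V, IsPathTo G S y P ∧ [u, v] <:+: P

/-- The sources lying on some `S`-`Y` path. -/
def revealedSources {V : Type*} (G : Digraph V) (S : Set V) (Y : Finset V) : Set V :=
  {u | u ∈ S ∧ ∃ y ∈ Y, ∃ P : List V, IsPathTo G S y P ∧ u ∈ P}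

/-- The same `S`-`Y` arcs and sources are visible in the two presentations. -/
def SameRevealed {V : Type*} (G : Digraph V) (S : Set V) (G' : Digraph V) (S' : Set V)
    (Y : Finset V) : Prop :=
  revealedGraph G S Y = revealedGraph G' S' Y ∧ revealedSources G S Y = revealedSources G' S' Y

/-- A canonical choice of witnesses: for each digraph `G`, set of sources `S` and linked set `X`,
a fixed collection `𝒫_X` of node-disjoint `S`-`X` paths (`paths G S X x` is the member of `𝒫_X`
ending at `x`) which depends only on the minimum subgraph containing all arcs of all
`S`-`X` paths (and on the sources in it). -/
structure WitnessRule (V : Type*) where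
  paths : Digraph V → Set V → Finset V → V → List V
  isLinking : ∀ G S X, Linked G S X → IsLinking G S X (paths G S X)
  locality : ∀ G S G' S' X, SameRevealed G S G' S' X →
    ∀ x ∈ X, paths G S X x = paths G' S' X x

/-- A gammoid presentation `(G, S, R)` with totally ordered terminal set
`R = {r^1 ≻ r^2 ≻ ⋯ ≻ r^n}`; the terminal `r^(k+1)` is `terminal k`. -/
structure OrderedGammoid (V : Type*) (n : ℕ) where
  G : Digraph V
  S : Set V
  terminal : Fin n ↪ V

/-- An algorithm that draws `s ∼ Bin(n, p)`; `select s σ` is its output for the sample size `s`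
and the arrival order `σ`, in which the element arriving at time `j + 1` is the one of
value rank `σ j`. -/
structure SamplingAlgorithm (V : Type*) (n : ℕ) where
  p : unitInterval
  select : ℕ → Equiv.Perm (Fin n) → Finset V

namespace OrderedGammoid

variable {V : Type*} [DecidableEq V] {n : ℕ}

/-- The set `R` of terminals. -/
def ground (Γ : OrderedGammoid V n) : Finset V := Finset.univ.map Γ.terminal

/-- Independence in the gammoid `Γ(G, S, R)`. -/
def Indep (Γ : OrderedGammoid V n) (X : Finset V) : Prop := X ⊆ Γ.ground ∧ Linked Γ.G Γ.S X

open scoped Classical in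
/-- `OPT(Q)`: the greedy algorithm applied to the elements of `Q` in decreasing value order. -/
def opt (Γ : OrderedGammoid V n) (Q : Finset V) : Finset V :=
  (((List.finRange n).map Γ.terminal).filter (fun r => r ∈ Q)).foldl
    (fun A r => if Γ.Indep (insert r A) then insert r A else A) ∅

/-- `R_i`, the set of the first `i` arriving terminals. -/
def arrived (Γ : OrderedGammoid V n) (σ : Equiv.Perm (Fin n)) (i : ℕ) : Finset V :=
  (Finset.univ.filter (fun j : Fin n => (j : ℕ) < i)).image (fun j => Γ.terminal (σ j))

open scoped Classical in
/-- The exchangeability: the maximum, over all independent sets `X` and all paths `Q` linking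
a terminal `r ∉ X` to `S`, of the number of paths of `𝒫_X` that `Q` intersects. -/
def exchangeability (Γ : OrderedGammoid V n) (W : WitnessRule V) : ℕ :=
  sSup {m : ℕ | ∃ X : Finset V, Γ.Indep X ∧ ∃ r ∈ Γ.ground, r ∉ X ∧
    ∃ Q : List V, IsPathTo Γ.G Γ.S r Q ∧
      m = (X.filter (fun x => ¬ (W.paths Γ.G Γ.S X x).Disjoint Q)).card}

/-- An algorithm has forbidden sets of size `k`. (Times are `0`-based: `t : Fin n` is the
`(t+1)`-st arrival, so that an arrival time of at least `s + 1` means `s ≤ t`, and the set of elements arrived up to and including `t` is `arrived σ (t + 1)`.) -/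
structure HasForbiddenSets (Γ : OrderedGammoid V n) (A : SamplingAlgorithm V n) (k : ℕ) :
    Prop where
  correctness : ∀ s ≤ n, ∀ σ, Γ.Indep (A.select s σ)
  sampling : ∀ s ≤ n, ∀ σ, ∀ j : Fin n, (j : ℕ) < s → Γ.terminal (σ j) ∉ A.select s σ
  forbidden : ∃ F : Finset V → Finset V → V → Finset V,
    (∀ Y ⊆ Γ.ground, ∀ r ∈ Γ.opt Y, ∀ X ⊆ Y.erase r, F X Y r ⊆ X ∧ (F X Y r).card ≤ k) ∧
    ∀ s ≤ n, ∀ σ, ∀ t : Fin n, s ≤ (t : ℕ) →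
      Γ.terminal (σ t) ∈ Γ.opt (Γ.arrived σ (t + 1)) →
      (∀ j : Fin n, s ≤ (j : ℕ) → j < t →
        Γ.terminal (σ j) ∉
          F (Γ.arrived σ (j + 1)) (Γ.arrived σ (t + 1)) (Γ.terminal (σ t))) →
      Γ.terminal (σ t) ∈ A.select s σ

open scoped Classical in
/-- The state `(ALG, 𝒫)` of the path-based algorithm with sample size `s` after `i` arrivals:
from the arrival number `s + 1` on, the arriving terminal `r` is selected if it belongs to the
current optimum `OPT(R_i)` and no vertex of its path in the canonical witness
`𝒫_{OPT(R_i)}` is covered by `𝒫`; this path is then added to `𝒫`. -/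
def pathState (Γ : OrderedGammoid V n) (W : WitnessRule V) (s : ℕ) (σ : Equiv.Perm (Fin n)) :
    ℕ → Finset V × Finset (List V)
  | 0 => (∅, ∅)
  | i + 1 =>
    let st := pathState Γ W s σ i
    if h : i < n then
      let r := Γ.terminal (σ ⟨i, h⟩)
      let X := Γ.opt (Γ.arrived σ (i + 1))
      let Q := W.paths Γ.G Γ.S X r
      if s ≤ i ∧ r ∈ X ∧ ∀ P ∈ st.2, P.Disjoint Q then (insert r st.1, insert Q st.2) else st
    else st

/-- The path-based algorithm for gammoids with sampling probability `p`. -/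
def pathAlgorithm (Γ : OrderedGammoid V n) (W : WitnessRule V) (p : unitInterval) :
    SamplingAlgorithm V n where
  p := p
  select s σ := (Γ.pathState W s σ n).1

/-- What is revealed up to the `i`-th arrival is the same in both instances: the arrived
terminals in their order of arrival, their relative value order, and the subgraph formed by
the arcs (and the sources) on the paths from the sources to the arrived terminals. -/
def SameUpTo (Γ Γ' : OrderedGammoid V n) (σ σ' : Equiv.Perm (Fin n)) (i : ℕ) : Prop :=
  (∀ j : Fin n, (j : ℕ) < i → Γ.terminal (σ j) = Γ'.terminal (σ' j)) ∧
  (∀ j j' : Fin n, (j : ℕ) < i → (j' : ℕ) < i → (σ j < σ j' ↔ σ' j < σ' j')) ∧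
  SameRevealed Γ.G Γ.S Γ'.G Γ'.S (Γ.arrived σ i)

/-- `Pr(e ∈ ALG)`, for independent `s ∼ Bin(n, p)` and a uniformly random arrival order. -/
def probSelected (A : SamplingAlgorithm V n) (e : V) : ℝ :=
  ∫ s, ((Finset.univ.filter (fun σ : Equiv.Perm (Fin n) => e ∈ A.select s σ)).card : ℝ)
    / (Nat.factorial n : ℝ) ∂(ProbabilityTheory.binomial n A.p)

/-- The algorithm is `α ≥ 1` probability-competitive: each element of `OPT = OPT(R)` is
selected with probability at least `1 / α`. -/
def IsProbabilityCompetitive (Γ : OrderedGammoid V n) (A : SamplingAlgorithm V n) (α : ℝ) :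
    Prop :=
  1 ≤ α ∧ ∀ e ∈ Γ.opt Γ.ground, 1 / α ≤ probSelected A e

end OrderedGammoid

/-- The sampling probability `p(k)`. -/
def samplingProb (k : ℕ) : ℝ :=
  if k = 1 then 1 / Real.exp 1 else (k : ℝ) ^ (-(1 / ((k : ℝ) - 1)))

/-- The ratio `α(k)`. -/
def ratio (k : ℕ) : ℝ :=
  if k = 1 then Real.exp 1 else (k : ℝ) ^ ((k : ℝ) / ((k : ℝ) - 1))

theorem samplingProb_mem (k : ℕ) (hk : 1 ≤ k) : samplingProb k ∈ unitInterval := by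
  unfold samplingProb
  split_ifs with h
  · refine ⟨by positivity, ?_⟩
    rw [div_le_one (Real.exp_pos 1)]
    exact Real.one_le_exp zero_le_one
  · have h1 : (1 : ℝ) ≤ k := by exact_mod_cast hk
    refine ⟨by positivity, Real.rpow_le_one_of_one_le_of_nonpos h1 ?_⟩
    have : (0 : ℝ) ≤ 1 / ((k : ℝ) - 1) := by
      apply div_nonneg zero_le_one
      linarith
    linarith

end

/-! Linked sets satisfy the augmentation axiom. Paths to `X` are encoded by a map that steps
backwards along arcs and is injective off `S`; two such maps are combined along one alternating
orbit (`Linked.exists_insert`). Hence an element of OPT(R) lies in OPT(R_i) from its arrival on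
(`mem_opt_of_subset`).

A rejected terminal of OPT(R_t) has a candidate path meeting the path of an earlier selected r_j.
That r_j lies in OPT(R_j), and its path belongs to the canonical witness of OPT(R_j), so
exchangeability bounds the number of such elements of R_j.

For the probability, fix e in OPT and call an order favorable at t if e arrives at t and no r_j with
s < j < t is forbidden for e. Given R_j and the later arrivals, r_j is uniform on R_j. The fraction
a_s of orders favorable at some time therefore satisfies a_s ≥ 1/n + (1 - μ/(s+1)) a_{s+1} and a_n =
0 (`favorableFraction_step`). Averaging over s ∼ Bin(n, x) gives the Bernstein sum B(x), for which
the recursion becomes x B' ≤ μ B - x. Integrating (B/x^μ)' ≤ -x^(-μ) from x to 1 yields B(x) ≥ x^μ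
∫_x^1 y^(-μ) dy; at x = p(μ) the integral is 1 and the bound is p^μ = 1/α
(`bernsteinSum_add_nonneg`, `exists_primitive_inv_pow`).

Locality holds because independence, greedy and the canonical paths use only paths to arrived
terminals. -/

/-! ### Linkings as injective backward maps; augmentation -/

/-- Cancel `f` on both sides until one exponent is 0; a positive remaining exponent would make a
starting point a value of `f`. -/
theorem iterate_eq_iterate_of_injOn {α : Type*} {f : α → α} {D : Set α} (hf : Set.InjOn f D)
    {x x' : α} (hx : x ∉ f '' D) (hx' : x' ∉ f '' D) :
    ∀ {a b : ℕ}, (∀ i < a, f^[i] x ∈ D) → (∀ j < b, f^[j] x' ∈ D) → f^[a] x = f^[b] x' →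
      a = b ∧ x = x'
  | 0, 0, _, _, h => ⟨rfl, h⟩
  | 0, b + 1, _, hb, h => by
    rw [Function.iterate_succ_apply'] at h
    exact absurd ⟨_, hb b (by omega), h.symm⟩ hx
  | a + 1, 0, ha, _, h => by
    rw [Function.iterate_succ_apply'] at h
    exact absurd ⟨_, ha a (by omega), h⟩ hx'
  | a + 1, b + 1, ha, hb, h => by
    rw [Function.iterate_succ_apply', Function.iterate_succ_apply'] at h
    have := iterate_eq_iterate_of_injOn hf hx hx' (fun i hi => ha i (by omega))
      (fun i hi => hb i (by omega)) (hf (ha a (by omega)) (hb b (by omega)) h)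
    exact ⟨by omega, this.2⟩

/-- An orbit that stayed in `D` forever would never repeat, which finiteness forbids. -/
theorem exists_first_iterate_notMem {α : Type*} [Finite α] {f : α → α} {D : Set α}
    (hf : Set.InjOn f D) {x : α} (hx : x ∉ f '' D) :
    ∃ k, f^[k] x ∉ D ∧ ∀ i < k, f^[i] x ∈ D := by
  classical
  have h : ∃ k, f^[k] x ∉ D := by
    by_contra! h
    exact not_injective_infinite_finite (fun i : ℕ => f^[i] x) fun a b hab =>
      (iterate_eq_iterate_of_injOn hf hx hx (fun i _ => h i) (fun i _ => h i) hab).1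
  exact ⟨Nat.find h, Nat.find_spec h, fun i hi => not_not.1 (Nat.find_min h hi)⟩

/-- A map moving every vertex outside `S` to itself or to an in-neighbour, injectively, and
with no value in `X`. Such maps describe the linkings of `X` to `S`. -/
structure IsBackwardMap {V : Type*} (G : Digraph V) (S : Set V) (X : Finset V) (φ : V → V) :
    Prop where
  injOn : Set.InjOn φ Sᶜ
  adj : ∀ v ∉ S, φ v = v ∨ G.Adj (φ v) v
  avoid : ∀ v ∉ S, φ v ∉ X

/-- Path vertices outside `S` go to their predecessor, all others stay fixed. A member of `X` ends
its own path and lies on no other, so it is never a predecessor. -/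
theorem Linked.exists_isBackwardMap {V : Type*} {G : Digraph V} {S : Set V} {X : Finset V}
    (h : Linked G S X) : ∃ φ, IsBackwardMap G S X φ := by
  obtain ⟨P, hP, hdisj⟩ := h
  have same : ∀ {x y w}, x ∈ X → y ∈ X → w ∈ P x → w ∈ P y → x = y := by
    intro x y w hx hy h1 h2
    by_contra hne
    exact hdisj x hx y hy hne h1 h2
  have inj : ∀ {x w : V} {i j : ℕ}, x ∈ X → (P x)[i]? = some w → (P x)[j]? = some w → i = j := by
    intro x i j w hx hi hj
    have hi' := (List.getElem?_eq_some_iff.1 hi).1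
    exact (List.getElem?_inj hi' (hP x hx).2.1).1 (hi.trans hj.symm)
  have mem : ∀ {x w : V} {i : ℕ}, (P x)[i]? = some w → w ∈ P x := fun h => List.mem_of_getElem? h
  have ex : ∀ v, ∃ w, v ∉ S → (∃ x ∈ X, ∃ i, (P x)[i]? = some w ∧ (P x)[i + 1]? = some v) ∨
      (w = v ∧ ∀ x ∈ X, v ∉ P x) := by
    intro v
    by_cases hv : v ∈ S
    · exact ⟨v, fun h => absurd hv h⟩
    by_cases hx : ∃ x ∈ X, v ∈ P x
    · obtain ⟨x, hx, hvx⟩ := hx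
      obtain ⟨i, hi⟩ := List.mem_iff_getElem?.1 hvx
      rcases i with _ | i
      · obtain ⟨u, hu, hhead⟩ := (hP x hx).2.2.1
        rw [List.head?_eq_getElem?, hi] at hhead
        cases hhead
        exact absurd hu hv
      · have hlt := (List.getElem?_eq_some_iff.1 hi).1
        exact ⟨(P x)[i], fun _ => Or.inl ⟨x, hx, i, by simp, hi⟩⟩
    · push Not at hx
      exact ⟨v, fun _ => Or.inr ⟨rfl, hx⟩⟩
  choose φ hφ using ex
  refine ⟨φ, ?_, ?_, ?_⟩
  · intro v hv v' hv' heq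
    rcases hφ v hv with ⟨x, hx, i, hi, hi'⟩ | ⟨h1, h2⟩ <;>
    rcases hφ v' hv' with ⟨y, hy, j, hj, hj'⟩ | ⟨h3, h4⟩
    · rw [heq] at hi
      obtain rfl := same hx hy (mem hi) (mem hj)
      obtain rfl := inj hx hi hj
      exact Option.some.inj (hi'.symm.trans hj')
    · rw [heq, h3] at hi
      exact absurd (mem hi) (h4 x hx)
    · rw [← heq, h1] at hj
      exact absurd (mem hj) (h2 y hy)
    · rw [← h1, ← h3, heq]
  · intro v hv
    rcases hφ v hv with ⟨x, hx, i, hi, hi'⟩ | ⟨h1, h2⟩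
    · right
      have hc := List.isChain_iff_getElem.1 (hP x hx).1
      obtain ⟨hlt, h2⟩ := List.getElem?_eq_some_iff.1 hi'
      obtain ⟨hlt', h3⟩ := List.getElem?_eq_some_iff.1 hi
      have := hc i hlt
      rwa [h2, h3] at this
    · exact Or.inl h1
  · intro v hv hmem
    have hlast := (hP _ hmem).2.2.2
    rw [List.getLast?_eq_getElem?] at hlast
    rcases hφ v hv with ⟨x, hx, i, hi, hi'⟩ | ⟨h1, h2⟩
    · obtain rfl := same hx hmem (mem hi) (mem hlast)
      have := inj hx hi hlast
      have := (List.getElem?_eq_some_iff.1 hi').1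
      omega
    · rw [h1] at hmem hlast
      exact h2 v hmem (mem hlast)

/-- Iterate `φ` from each `x ∈ X` until `S` is reached. As `x` is not a value of `φ` off `S`,
injectivity makes these orbits simple and disjoint. -/
theorem IsBackwardMap.linked {V : Type*} [Finite V] {G : Digraph V} {S : Set V} {X : Finset V}
    {φ : V → V} (h : IsBackwardMap G S X φ) : Linked G S X := by
  have hX : ∀ x ∈ X, x ∉ φ '' Sᶜ := by
    rintro x hx ⟨v, hv, rfl⟩
    exact h.avoid v hv hx
  have ex : ∀ x, ∃ k, x ∈ X → φ^[k] x ∉ Sᶜ ∧ ∀ i < k, φ^[i] x ∈ Sᶜ := by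
    intro x
    by_cases hx : x ∈ X
    · obtain ⟨k, hk⟩ := exists_first_iterate_notMem h.injOn (hX x hx)
      exact ⟨k, fun _ => hk⟩
    · exact ⟨0, fun h => absurd h hx⟩
  choose k hk using ex
  have key : ∀ {x y}, x ∈ X → y ∈ X → ∀ {a b}, a ≤ k x → b ≤ k y → φ^[a] x = φ^[b] y →
      a = b ∧ x = y := fun {x y} hx hy {a b} ha hb hab =>
    iterate_eq_iterate_of_injOn h.injOn (hX x hx) (hX y hy)
      (fun i hi => (hk x hx).2 i (by omega)) (fun i hi => (hk y hy).2 i (by omega)) hab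
  refine ⟨fun x => (List.range (k x + 1)).map fun i => φ^[k x - i] x, fun x hx => ⟨?_, ?_, ?_, ?_⟩,
    ?_⟩
  · rw [List.isChain_iff_getElem]
    intro i hi
    simp only [List.length_map, List.length_range] at hi
    simp only [List.getElem_map, List.getElem_range]
    have e : k x - i = (k x - (i + 1)) + 1 := by omega
    rw [e, Function.iterate_succ_apply']
    -- A fixed point would repeat a vertex of the orbit, so the step is a genuine arc.
    refine (h.adj _ ((hk x hx).2 (k x - (i + 1)) (by omega))).resolve_left fun hfix => ?_
    rw [← Function.iterate_succ_apply' φ] at hfix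
    have := (key hx hx (by omega) (by omega) hfix).1
    omega
  · refine List.Nodup.map_on ?_ List.nodup_range
    intro i hi j hj hij
    rw [List.mem_range] at hi hj
    have := (key hx hx (by omega) (by omega) hij).1
    omega
  · refine ⟨φ^[k x] x, not_not.1 (hk x hx).1, ?_⟩
    simp [List.head?_eq_getElem?]
  · simp [List.getLast?_eq_getElem?]
  · intro x hx y hy hne w hwx hwy
    simp only [List.mem_map, List.mem_range] at hwx hwy
    obtain ⟨i, hi, rfl⟩ := hwx
    obtain ⟨j, hj, hij⟩ := hwy
    exact hne (key hx hy (by omega) (by omega) hij.symm).2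

theorem Linked.mono {V : Type*} {G : Digraph V} {S : Set V} {X Y : Finset V} (h : Linked G S Y)
    (hXY : X ⊆ Y) : Linked G S X := by
  obtain ⟨P, h1, h2⟩ := h
  exact ⟨P, fun x hx => h1 x (hXY hx), fun x hx y hy => h2 x (hXY hx) y (hXY hy)⟩

/-- The augmentation axiom for the linked sets of a digraph. -/
theorem Linked.exists_insert {V : Type*} [Finite V] [DecidableEq V] {G : Digraph V} {S : Set V}
    {X Z : Finset V} (hX : Linked G S X) (hZ : Linked G S Z) (hlt : X.card < Z.card) :
    ∃ z ∈ Z, z ∉ X ∧ Linked G S (insert z X) := by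
  classical
  obtain ⟨φ, hφ⟩ := hX.exists_isBackwardMap
  obtain ⟨ψ, hψ⟩ := hZ.exists_isBackwardMap
  let B := φ '' Sᶜ
  have inv : ∀ w, ∃ u, w ∈ B → u ∈ ψ '' Sᶜ ∧ ∀ v, v ∉ S → φ v = w → ψ v = u := by
    intro w
    by_cases hw : w ∈ B
    · obtain ⟨v, hv, rfl⟩ := hw
      refine ⟨ψ v, fun _ => ⟨⟨v, hv, rfl⟩, fun v' hv' he => ?_⟩⟩
      rw [hφ.injOn hv' hv he]
    · exact ⟨w, fun h => absurd h hw⟩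
  -- `g` is ψ ∘ φ⁻¹ on `B`; its orbits starting in `Z` are the alternating paths.
  choose g hg using inv
  have hgφ : ∀ v, v ∉ S → ψ v = g (φ v) := fun v hv => (hg _ ⟨v, hv, rfl⟩).2 v hv rfl
  have hginj : Set.InjOn g B := by
    rintro _ ⟨v, hv, rfl⟩ _ ⟨v', hv', rfl⟩ he
    rw [← hgφ v hv, ← hgφ v' hv'] at he
    rw [hψ.injOn hv hv' he]
  have hgZ : ∀ w ∈ B, g w ∉ Z := by
    rintro _ ⟨v, hv, rfl⟩
    rw [← hgφ v hv]
    exact hψ.avoid v hv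
  have hBX : ∀ w ∈ B, w ∉ X := by
    rintro _ ⟨v, hv, rfl⟩
    exact hφ.avoid v hv
  have hZg : ∀ z ∈ Z, z ∉ g '' B := by
    rintro z hz ⟨w, hw, rfl⟩
    exact hgZ w hw hz
  have ex : ∀ z, ∃ k, z ∈ Z → g^[k] z ∉ B ∧ ∀ i < k, g^[i] z ∈ B := by
    intro z
    by_cases hz : z ∈ Z
    · obtain ⟨k, hk⟩ := exists_first_iterate_notMem hginj (hZg z hz)
      exact ⟨k, fun _ => hk⟩
    · exact ⟨0, fun h => absurd h hz⟩
  choose k hk using ex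
  -- If every orbit from `Z \ X` ended in `X`, its endpoint would be a value of `g`, hence outside
  -- `Z`, and `Z \ X` would inject into `X \ Z`.
  obtain ⟨z, hz, hzX, hend⟩ : ∃ z ∈ Z, z ∉ X ∧ g^[k z] z ∉ X := by
    by_contra! hcon
    have hcard : (Z \ X).card ≤ (X \ Z).card := by
      refine Finset.card_le_card_of_injOn (fun z => g^[k z] z) ?_ ?_
      · intro z hz
        simp only [Finset.coe_sdiff, Set.mem_sdiff, Finset.mem_coe] at hz ⊢
        refine ⟨hcon z hz.1 hz.2, ?_⟩
        rcases hkz : k z with _ | m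
        · have := hcon z hz.1 hz.2
          rw [hkz] at this
          exact absurd this hz.2
        · rw [Function.iterate_succ_apply']
          exact hgZ _ ((hk z hz.1).2 m (by omega))
      · intro z hz z' hz' he
        simp only [Finset.coe_sdiff, Set.mem_sdiff, Finset.mem_coe] at hz hz'
        exact (iterate_eq_iterate_of_injOn hginj (hZg z hz.1) (hZg z' hz'.1) (hk z hz.1).2
          (hk z' hz'.1).2 he).2
    have h1 := Finset.card_sdiff_add_card_inter Z X
    have h2 := Finset.card_sdiff_add_card_inter X Z
    rw [Finset.inter_comm] at h2
    omega
  refine ⟨z, hz, hzX, ?_⟩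
  obtain ⟨hkB, hkB'⟩ := hk z hz
  -- Replacing φ by ψ at these vertices removes `z` from the image and adds only the endpoint of the
  -- orbit, which is outside `X`.
  let onPath : V → Prop := fun v => ∃ i < k z, g^[i] z = φ v
  have step : ∀ v, v ∉ S → onPath v → ∃ i, i < k z ∧ ψ v = g^[i + 1] z := by
    rintro v hv ⟨i, hi, he⟩
    exact ⟨i, hi, by rw [Function.iterate_succ_apply', he, hgφ v hv]⟩
  have cross : ∀ v v', v ∉ S → v' ∉ S → onPath v → ψ v = φ v' → onPath v' := by
    intro v v' hv hv' hon he
    obtain ⟨i, hi, hi'⟩ := step v hv hon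
    rcases Nat.lt_or_ge (i + 1) (k z) with h | h
    · exact ⟨i + 1, h, by rw [← hi', he]⟩
    · have e : i + 1 = k z := by omega
      rw [e] at hi'
      exact absurd ⟨v', hv', by rw [← he, hi']⟩ hkB
  refine IsBackwardMap.linked (φ := fun v => if onPath v then ψ v else φ v) ⟨?_, ?_, ?_⟩
  · intro v hv v' hv' he
    by_cases h1 : onPath v <;> by_cases h2 : onPath v' <;>
      simp only [h1, h2, if_true, if_false] at he
    · exact hψ.injOn hv hv' he
    · exact absurd (cross v v' hv hv' h1 he) h2
    · exact absurd (cross v' v hv' hv h2 he.symm) h1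
    · exact hφ.injOn hv hv' he
  · intro v hv
    split_ifs
    · exact hψ.adj v hv
    · exact hφ.adj v hv
  · intro v hv
    rw [Finset.mem_insert, not_or]
    split_ifs with h1
    · refine ⟨fun he => hψ.avoid v hv (he ▸ hz), ?_⟩
      obtain ⟨i, hi, hi'⟩ := step v hv h1
      rw [hi']
      rcases Nat.lt_or_ge (i + 1) (k z) with h | h
      · exact hBX _ (hkB' _ h)
      · rwa [show i + 1 = k z by omega]
    · refine ⟨fun he => h1 ?_, hφ.avoid v hv⟩
      refine ⟨0, Nat.pos_of_ne_zero fun h0 => ?_, he.symm⟩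
      rw [h0] at hkB
      exact hkB ⟨v, hv, he⟩

/-! ### The greedy algorithm for an independence predicate -/

open scoped Classical in
/-- The greedy algorithm for the independence predicate `p`, run on a list from the start `A`. -/
noncomputable def greedy {V : Type*} [DecidableEq V] (p : Finset V → Prop) (A : Finset V)
    (L : List V) : Finset V :=
  L.foldl (fun A r => if p (insert r A) then insert r A else A) A

section greedy

variable {V : Type*} [DecidableEq V] {p : Finset V → Prop}

theorem greedy_cons_of_pos {A : Finset V} {r : V} (h : p (insert r A)) (L : List V) :
    greedy p A (r :: L) = greedy p (insert r A) L := by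
  simp [greedy, h]

theorem greedy_cons_of_neg {A : Finset V} {r : V} (h : ¬ p (insert r A)) (L : List V) :
    greedy p A (r :: L) = greedy p A L := by
  simp [greedy, h]

theorem greedy_append (A : Finset V) (L L' : List V) :
    greedy p A (L ++ L') = greedy p (greedy p A L) L' := by
  simp [greedy]

theorem greedy_spec (A : Finset V) (hA : p A) (L : List V) : p (greedy p A L) := by
  induction L generalizing A with
  | nil => exact hA
  | cons r L ih =>
    by_cases h : p (insert r A)
    · rw [greedy_cons_of_pos h]; exact ih _ h
    · rw [greedy_cons_of_neg h]; exact ih _ hA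

theorem subset_greedy (A : Finset V) (L : List V) : A ⊆ greedy p A L := by
  induction L generalizing A with
  | nil => exact subset_rfl
  | cons r L ih =>
    by_cases h : p (insert r A)
    · rw [greedy_cons_of_pos h]; exact (Finset.subset_insert _ _).trans (ih _)
    · rw [greedy_cons_of_neg h]; exact ih _

theorem mem_or_mem_of_mem_greedy {A : Finset V} {L : List V} {x : V} (hx : x ∈ greedy p A L) :
    x ∈ A ∨ x ∈ L := by
  induction L generalizing A with
  | nil => exact Or.inl hx
  | cons r L ih =>
    by_cases h : p (insert r A)
    · rw [greedy_cons_of_pos h] at hx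
      rcases ih hx with h | h
      · rcases Finset.mem_insert.1 h with rfl | h
        · simp
        · exact Or.inl h
      · simp [h]
    · rw [greedy_cons_of_neg h] at hx
      rcases ih hx with h | h <;> simp [h]

theorem greedy_maximal (hp : ∀ X Y, X ⊆ Y → p Y → p X) {A : Finset V} {L : List V} {x : V}
    (hx : x ∈ L) (h : p (insert x (greedy p A L))) : x ∈ greedy p A L := by
  induction L generalizing A with
  | nil => simp at hx
  | cons r L ih =>
    by_cases hr : p (insert r A)
    · rw [greedy_cons_of_pos hr] at h ⊢
      rcases List.mem_cons.1 hx with rfl | hx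
      · exact subset_greedy _ _ (Finset.mem_insert_self _ _)
      · exact ih hx h
    · rw [greedy_cons_of_neg hr] at h ⊢
      rcases List.mem_cons.1 hx with rfl | hx
      · exact absurd (hp _ _ (Finset.insert_subset_insert _ (subset_greedy _ _)) h) hr
      · exact ih hx h

/-- The decision on `e` is made once, from the elements preceding it. -/
theorem mem_greedy_middle_iff {A : Finset V} {L L' : List V} {e : V} (hA : e ∉ A) (hL : e ∉ L)
    (hL' : e ∉ L') : e ∈ greedy p A (L ++ e :: L') ↔ p (insert e (greedy p A L)) := by
  rw [greedy_append]
  by_cases h : p (insert e (greedy p A L))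
  · rw [greedy_cons_of_pos h]
    exact iff_of_true (subset_greedy _ _ (Finset.mem_insert_self _ _)) h
  · rw [greedy_cons_of_neg h]
    refine iff_of_false (fun he => ?_) h
    rcases mem_or_mem_of_mem_greedy he with he | he
    · rcases mem_or_mem_of_mem_greedy he with he | he
      · exact hA he
      · exact hL he
    · exact hL' he

/-- An element not spanned by the greedy set of a list is not spanned by that of any part. -/
theorem insert_greedy_of_subset (hp0 : p ∅) (hp : ∀ X Y, X ⊆ Y → p Y → p X)
    (haug : ∀ X Z, p X → p Z → X.card < Z.card → ∃ z ∈ Z, z ∉ X ∧ p (insert z X))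
    {L L' : List V} (hL : L' ⊆ L) {e : V} (he : e ∉ L) (h : p (insert e (greedy p ∅ L))) :
    p (insert e (greedy p ∅ L')) := by
  classical
  have sub : ∀ M : List V, greedy p ∅ M ⊆ M.toFinset := fun M x hx => by
    simpa using mem_or_mem_of_mem_greedy hx
  -- `J` is a largest independent extension of the smaller greedy set inside `L`. It is no larger
  -- than the greedy set of `L`, so it can be augmented from that set with `e` added; by maximality
  -- the new element is `e`.
  obtain ⟨J, hJ, hJmax⟩ := Finset.exists_max_image
    (L.toFinset.powerset.filter fun J => p J ∧ greedy p ∅ L' ⊆ J) Finset.card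
    ⟨greedy p ∅ L', by
      simp only [Finset.mem_filter, Finset.mem_powerset]
      refine ⟨fun x hx => ?_, greedy_spec _ hp0 _, subset_rfl⟩
      have := sub _ hx
      simp only [List.mem_toFinset] at this ⊢
      exact hL this⟩
  simp only [Finset.mem_filter, Finset.mem_powerset] at hJ hJmax
  obtain ⟨hJL, hJp, hJsub⟩ := hJ
  have heg : e ∉ greedy p ∅ L := fun h' => he (by simpa using sub _ h')
  have hle : J.card ≤ (greedy p ∅ L).card := by
    by_contra! hlt
    obtain ⟨z, hz, hzn, hzp⟩ := haug _ _ (greedy_spec _ hp0 L) hJp hlt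
    exact hzn (greedy_maximal hp (by simpa using hJL hz) hzp)
  obtain ⟨z, hz, hzJ, hzp⟩ := haug J _ hJp h (by rw [Finset.card_insert_of_notMem heg]; omega)
  rcases Finset.mem_insert.1 hz with rfl | hz
  · exact hp _ _ (Finset.insert_subset_insert _ hJsub) hzp
  · have := hJmax (insert z J)
      ⟨Finset.insert_subset (sub _ hz) hJL, hzp, hJsub.trans (Finset.subset_insert _ _)⟩
    rw [Finset.card_insert_of_notMem hzJ] at this
    omega

/-- Greedy tests only subsets of `Q`, so agreement there suffices; used for locality. -/
theorem greedy_congr {q : Finset V → Prop} {A Q : Finset V} (hA : A ⊆ Q)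
    (h : ∀ X ⊆ Q, (p X ↔ q X)) {L : List V} (hL : ∀ x ∈ L, x ∈ Q) :
    greedy p A L = greedy q A L := by
  induction L generalizing A with
  | nil => rfl
  | cons r L ih =>
    have hins : insert r A ⊆ Q := Finset.insert_subset (hL r (by simp)) hA
    have hL' : ∀ x ∈ L, x ∈ Q := fun x hx => hL x (by simp [hx])
    by_cases hr : p (insert r A)
    · rw [greedy_cons_of_pos hr, greedy_cons_of_pos ((h _ hins).1 hr), ih hins hL']
    · rw [greedy_cons_of_neg hr, greedy_cons_of_neg (mt (h _ hins).2 hr), ih hA hL']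

end greedy

/-! ### Greedy optima of the gammoid -/

namespace OrderedGammoid

variable {V : Type*} {n : ℕ} (Γ : OrderedGammoid V n)

theorem indep_empty : Γ.Indep ∅ := ⟨by simp, fun _ => [], by simp [IsLinking]⟩

theorem Indep.subset {Γ : OrderedGammoid V n} {X Y : Finset V} (h : Γ.Indep Y) (hXY : X ⊆ Y) :
    Γ.Indep X := ⟨hXY.trans h.1, h.2.mono hXY⟩

variable [DecidableEq V]

/-- The elements of `Q` in decreasing order of value. -/
def sortedTerminals (Q : Finset V) : List V :=
  ((List.finRange n).map Γ.terminal).filter (fun r => r ∈ Q)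

theorem opt_eq_greedy (Q : Finset V) : Γ.opt Q = greedy Γ.Indep ∅ (Γ.sortedTerminals Q) := rfl

theorem Indep.exists_insert [Finite V] {Γ : OrderedGammoid V n} {X Z : Finset V}
    (hX : Γ.Indep X) (hZ : Γ.Indep Z) (h : X.card < Z.card) :
    ∃ z ∈ Z, z ∉ X ∧ Γ.Indep (insert z X) := by
  obtain ⟨z, hz, hzX, hl⟩ := hX.2.exists_insert hZ.2 h
  exact ⟨z, hz, hzX, Finset.insert_subset (hZ.1 hz) hX.1, hl⟩

theorem indep_opt (Q : Finset V) : Γ.Indep (Γ.opt Q) := greedy_spec _ Γ.indep_empty _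

theorem opt_subset (Q : Finset V) : Γ.opt Q ⊆ Q := by
  intro x hx
  rcases mem_or_mem_of_mem_greedy hx with h | h
  · simp at h
  · simpa using (List.mem_filter.1 h).2

/-- An optimal element stays optimal in every subset that contains it. -/
theorem mem_opt_of_subset [Finite V] {Q Y : Finset V} (hY : Y ⊆ Q) {e : V} (he : e ∈ Γ.opt Q)
    (heY : e ∈ Y) : e ∈ Γ.opt Y := by
  have hmem : e ∈ (List.finRange n).map Γ.terminal := by
    rcases mem_or_mem_of_mem_greedy he with h | h
    · simp at h
    · exact (List.mem_filter.1 h).1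
  have hnd : ((List.finRange n).map Γ.terminal).Nodup :=
    (List.nodup_finRange n).map Γ.terminal.injective
  obtain ⟨L₁, L₂, hL⟩ := List.append_of_mem hmem
  rw [hL, List.nodup_middle, List.nodup_cons, List.mem_append, not_or] at hnd
  -- Membership of `e` is decided by the more valuable terminals `L₁` alone.
  have split : ∀ Q : Finset V, e ∈ Q → (e ∈ Γ.opt Q ↔
      Γ.Indep (insert e (greedy Γ.Indep ∅ (L₁.filter (fun r => r ∈ Q))))) := by
    intro Q heQ
    rw [opt_eq_greedy, sortedTerminals, hL, List.filter_append,
      List.filter_cons_of_pos (by simpa using heQ)]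
    exact mem_greedy_middle_iff (by simp) (fun h => hnd.1.1 (List.mem_filter.1 h).1)
      (fun h => hnd.1.2 (List.mem_filter.1 h).1)
  rw [split Y heY]
  refine insert_greedy_of_subset Γ.indep_empty (fun X Y h h' => h'.subset h)
    (fun X Z h h' => h.exists_insert h') ?_ (fun h => hnd.1.1 (List.mem_filter.1 h).1)
    ((split Q (Γ.opt_subset Q he)).1 he)
  intro x hx
  simp only [List.mem_filter, decide_eq_true_eq] at hx ⊢
  exact ⟨hx.1, hY hx.2⟩

end OrderedGammoid

/-! ### Locality of the revealed subgraph -/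

section revealed

variable {V : Type*} {G G' : Digraph V} {S S' : Set V} {Y Y' : Finset V}

theorem isPathTo_revealed_iff {y : V} (hy : y ∈ Y) {P : List V} :
    IsPathTo (revealedGraph G S Y) (revealedSources G S Y) y P ↔ IsPathTo G S y P := by
  constructor
  · rintro ⟨h1, h2, ⟨u, hu, hu'⟩, h4⟩
    refine ⟨h1.imp ?_, h2, ⟨u, hu.1, hu'⟩, h4⟩
    rintro a b ⟨z, -, Q, hQ, hab⟩
    simpa using hQ.1.infix hab
  · intro h
    obtain ⟨h1, h2, ⟨u, hu, hu'⟩, h4⟩ := id h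
    refine ⟨(List.isChain_isInfix P).imp fun a b hab => ⟨y, hy, P, h, hab⟩, h2,
      ⟨u, ⟨hu, y, hy, P, h, List.mem_of_mem_head? hu'⟩, hu'⟩, h4⟩

theorem SameRevealed.isPathTo_iff (h : SameRevealed G S G' S' Y) {y : V} (hy : y ∈ Y)
    {P : List V} : IsPathTo G S y P ↔ IsPathTo G' S' y P := by
  rw [← isPathTo_revealed_iff hy, h.1, h.2, isPathTo_revealed_iff hy]

theorem SameRevealed.mono (h : SameRevealed G S G' S' Y) (hY : Y' ⊆ Y) :
    SameRevealed G S G' S' Y' := by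
  have key : ∀ y ∈ Y', ∀ P, IsPathTo G S y P ↔ IsPathTo G' S' y P :=
    fun y hy P => h.isPathTo_iff (hY hy)
  constructor
  · ext u v
    constructor
    · rintro ⟨y, hy, P, hP, huv⟩
      exact ⟨y, hy, P, (key y hy P).1 hP, huv⟩
    · rintro ⟨y, hy, P, hP, huv⟩
      exact ⟨y, hy, P, (key y hy P).2 hP, huv⟩
  · ext u
    -- A vertex on a path to `Y'` also lies on a path to `Y`, where the revealed sources agree.
    have hu : ∀ {y P}, y ∈ Y' → IsPathTo G S y P → u ∈ P → (u ∈ S ↔ u ∈ S') := by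
      intro y P hy hP huP
      have := congrArg (u ∈ ·) h.2
      simp only [revealedSources, Set.mem_ofPred_eq, eq_iff_iff] at this
      constructor
      · exact fun hS => (this.1 ⟨hS, y, hY hy, P, hP, huP⟩).1
      · exact fun hS => (this.2 ⟨hS, y, hY hy, P, (key y hy P).1 hP, huP⟩).1
    constructor
    · rintro ⟨hS, y, hy, P, hP, huP⟩
      exact ⟨(hu hy hP huP).1 hS, y, hy, P, (key y hy P).1 hP, huP⟩
    · rintro ⟨hS, y, hy, P, hP, huP⟩
      have hP' := (key y hy P).2 hP
      exact ⟨(hu hy hP' huP).2 hS, y, hy, P, hP', huP⟩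

theorem SameRevealed.linked_iff (h : SameRevealed G S G' S' Y) (hY : Y' ⊆ Y) :
    Linked G S Y' ↔ Linked G' S' Y' := by
  unfold Linked IsLinking
  refine exists_congr fun P => and_congr_left fun _ => forall₂_congr fun x hx => ?_
  exact h.isPathTo_iff (hY hx)

end revealed

/-! ### The path-based algorithm: locality and forbidden sets -/

namespace OrderedGammoid

variable {V : Type*} [DecidableEq V] {n : ℕ} {Γ Γ' : OrderedGammoid V n}
  {σ σ' : Equiv.Perm (Fin n)} {i j s : ℕ}

theorem mem_arrived {x : V} :
    x ∈ Γ.arrived σ i ↔ ∃ j : Fin n, (j : ℕ) < i ∧ Γ.terminal (σ j) = x := by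
  simp [arrived]

theorem terminal_mem_arrived {k : Fin n} : Γ.terminal (σ k) ∈ Γ.arrived σ i ↔ (k : ℕ) < i := by
  rw [mem_arrived]
  constructor
  · rintro ⟨j, hj, h⟩
    rwa [← σ.injective (Γ.terminal.injective h)]
  · exact fun h => ⟨k, h, rfl⟩

theorem arrived_mono (h : i ≤ j) : Γ.arrived σ i ⊆ Γ.arrived σ j := by
  intro x
  simp only [mem_arrived]
  rintro ⟨k, hk, rfl⟩
  exact ⟨k, by omega, rfl⟩

omit [DecidableEq V] in
theorem terminal_mem_ground (k : Fin n) : Γ.terminal k ∈ Γ.ground := by simp [ground]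

theorem arrived_subset_ground : Γ.arrived σ i ⊆ Γ.ground := by
  intro x
  rw [mem_arrived]
  rintro ⟨k, hk, rfl⟩
  exact Γ.terminal_mem_ground _

theorem SameUpTo.arrived_eq (h : Γ.SameUpTo Γ' σ σ' i) : Γ.arrived σ i = Γ'.arrived σ' i := by
  ext x
  rw [mem_arrived, mem_arrived]
  exact exists_congr fun j => and_congr_right fun hj => by rw [h.1 j hj]

theorem SameUpTo.mono (h : Γ.SameUpTo Γ' σ σ' i) (hj : j ≤ i) : Γ.SameUpTo Γ' σ σ' j :=
  ⟨fun k hk => h.1 k (by omega), fun k k' hk hk' => h.2.1 k k' (by omega) (by omega),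
    h.2.2.mono (arrived_mono hj)⟩

theorem pairwise_sortedTerminals (Q : Finset V) : (Γ.sortedTerminals Q).Pairwise
    (fun a b => ∃ k l : Fin n, a = Γ.terminal k ∧ b = Γ.terminal l ∧ k < l) := by
  refine List.Pairwise.filter _ (List.pairwise_map.2 ?_)
  exact (List.pairwise_lt_finRange n).imp fun {a b} h => ⟨a, b, rfl, rfl, h⟩

theorem mem_sortedTerminals {Q : Finset V} (hQ : Q ⊆ Γ.ground) {x : V} :
    x ∈ Γ.sortedTerminals Q ↔ x ∈ Q := by
  simp only [sortedTerminals, List.mem_filter, List.mem_map, List.mem_finRange, true_and,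
    decide_eq_true_eq, and_iff_right_iff_imp]
  intro hx
  simpa [ground] using hQ hx

theorem nodup_sortedTerminals (Q : Finset V) : (Γ.sortedTerminals Q).Nodup :=
  ((List.nodup_finRange n).map Γ.terminal.injective).filter _

theorem SameUpTo.sortedTerminals_eq (h : Γ.SameUpTo Γ' σ σ' i) :
    Γ.sortedTerminals (Γ.arrived σ i) = Γ'.sortedTerminals (Γ'.arrived σ' i) := by
  have hm : ∀ {x}, x ∈ Γ.sortedTerminals (Γ.arrived σ i) ↔ x ∈ Γ.arrived σ i :=
    mem_sortedTerminals arrived_subset_ground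
  have hm' : ∀ {x}, x ∈ Γ'.sortedTerminals (Γ'.arrived σ' i) ↔ x ∈ Γ'.arrived σ' i :=
    mem_sortedTerminals arrived_subset_ground
  -- Writing the order through arrival times lets the agreement of relative ranks sort both lists by
  -- one relation.
  refine List.Perm.eq_of_pairwise (le := fun a b => ∃ k l : Fin n, (k : ℕ) < i ∧ (l : ℕ) < i ∧
    a = Γ.terminal (σ k) ∧ b = Γ.terminal (σ l) ∧ σ k < σ l) ?_ ?_ ?_ ?_
  · rintro a b - - ⟨k, l, hk, hl, rfl, rfl, hlt⟩ ⟨k', l', hk', hl', e1, e2, hlt'⟩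
    rw [← Γ.terminal.injective e1, ← Γ.terminal.injective e2] at hlt'
    exact absurd hlt hlt'.asymm
  · refine (pairwise_sortedTerminals _).imp_of_mem ?_
    rintro a b ha hb ⟨k, l, rfl, rfl, hlt⟩
    obtain ⟨k', hk', e⟩ := mem_arrived.1 (hm.1 ha)
    obtain ⟨l', hl', e'⟩ := mem_arrived.1 (hm.1 hb)
    refine ⟨k', l', hk', hl', e.symm, e'.symm, ?_⟩
    rwa [Γ.terminal.injective e, Γ.terminal.injective e']
  · refine (pairwise_sortedTerminals _).imp_of_mem ?_
    rintro a b ha hb ⟨k, l, rfl, rfl, hlt⟩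
    obtain ⟨k', hk', e⟩ := mem_arrived.1 (hm'.1 ha)
    obtain ⟨l', hl', e'⟩ := mem_arrived.1 (hm'.1 hb)
    refine ⟨k', l', hk', hl', by rw [h.1 _ hk', e], by rw [h.1 _ hl', e'], ?_⟩
    rw [h.2.1 _ _ hk' hl']
    rwa [Γ'.terminal.injective e, Γ'.terminal.injective e']
  · rw [List.perm_ext_iff_of_nodup (nodup_sortedTerminals _) (nodup_sortedTerminals _)]
    intro a
    rw [hm, hm', h.arrived_eq]

theorem SameUpTo.opt_eq (h : Γ.SameUpTo Γ' σ σ' i) :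
    Γ.opt (Γ.arrived σ i) = Γ'.opt (Γ'.arrived σ' i) := by
  rw [opt_eq_greedy, opt_eq_greedy, ← h.sortedTerminals_eq]
  refine greedy_congr (Q := Γ.arrived σ i) (by simp) ?_
    fun x hx => (mem_sortedTerminals arrived_subset_ground).1 hx
  intro X hX
  refine and_congr (iff_of_true (hX.trans arrived_subset_ground) ?_) (h.2.2.linked_iff hX)
  exact (h.arrived_eq ▸ hX).trans arrived_subset_ground

variable (Γ) (W : WitnessRule V)

/-- The path examined by the path-based algorithm at time `i`. -/
noncomputable def candidatePath (σ : Equiv.Perm (Fin n)) (i : Fin n) : List V :=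
  W.paths Γ.G Γ.S (Γ.opt (Γ.arrived σ (i + 1))) (Γ.terminal (σ i))

/-- The condition under which the path-based algorithm selects the terminal arriving at `i`. -/
def Accepts (s : ℕ) (σ : Equiv.Perm (Fin n)) (i : Fin n) : Prop :=
  s ≤ (i : ℕ) ∧ Γ.terminal (σ i) ∈ Γ.opt (Γ.arrived σ (i + 1)) ∧
    ∀ P ∈ (Γ.pathState W s σ i).2, P.Disjoint (Γ.candidatePath W σ i)

variable {Γ W}

theorem pathState_succ_of_accepts {i : Fin n} (h : Γ.Accepts W s σ i) :
    Γ.pathState W s σ (i + 1) = (insert (Γ.terminal (σ i)) (Γ.pathState W s σ i).1,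
      insert (Γ.candidatePath W σ i) (Γ.pathState W s σ i).2) := by
  rw [pathState]
  simp only [i.isLt, dite_true]
  exact if_pos h

theorem pathState_succ_of_not_accepts {i : Fin n} (h : ¬ Γ.Accepts W s σ i) :
    Γ.pathState W s σ (i + 1) = Γ.pathState W s σ i := by
  rw [pathState]
  simp only [i.isLt, dite_true]
  exact if_neg h

/-- The invariants of the path-based algorithm. -/
theorem pathState_invariant (hi : i ≤ n) :
    (∀ r ∈ (Γ.pathState W s σ i).1,
      ∃ j : Fin n, s ≤ (j : ℕ) ∧ (j : ℕ) < i ∧ r = Γ.terminal (σ j)) ∧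
    (∀ P ∈ (Γ.pathState W s σ i).2, ∃ j : Fin n, s ≤ (j : ℕ) ∧ (j : ℕ) < i ∧
      Γ.terminal (σ j) ∈ Γ.opt (Γ.arrived σ (j + 1)) ∧ P = Γ.candidatePath W σ j) ∧
    ∃ f : V → List V, IsLinking Γ.G Γ.S (Γ.pathState W s σ i).1 f ∧
      ∀ x ∈ (Γ.pathState W s σ i).1, f x ∈ (Γ.pathState W s σ i).2 := by
  induction i with
  | zero => simp [pathState, IsLinking]
  | succ i ih =>
    obtain ⟨h1, h2, f, hf, hf'⟩ := ih (by omega)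
    obtain ⟨i, rfl⟩ : ∃ k : Fin n, (k : ℕ) = i := ⟨⟨i, hi⟩, rfl⟩
    by_cases hacc : Γ.Accepts W s σ i
    · rw [pathState_succ_of_accepts hacc]
      obtain ⟨hs, hopt, hdisj⟩ := hacc
      refine ⟨?_, ?_, ?_⟩
      · intro r hr
        rcases Finset.mem_insert.1 hr with rfl | hr
        · exact ⟨i, hs, by omega, rfl⟩
        · obtain ⟨j, hj, hji, rfl⟩ := h1 r hr
          exact ⟨j, hj, by omega, rfl⟩
      · intro P hP
        rcases Finset.mem_insert.1 hP with rfl | hP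
        · exact ⟨i, hs, by omega, hopt, rfl⟩
        · obtain ⟨j, hj, hji, hjo, rfl⟩ := h2 P hP
          exact ⟨j, hj, by omega, hjo, rfl⟩
      · have hnew : Γ.terminal (σ i) ∉ (Γ.pathState W s σ i).1 := by
          intro h
          obtain ⟨j, -, hji, he⟩ := h1 _ h
          have := σ.injective (Γ.terminal.injective he)
          subst this
          omega
        have hpath : IsPathTo Γ.G Γ.S (Γ.terminal (σ i)) (Γ.candidatePath W σ i) :=
          (W.isLinking _ _ _ (Γ.indep_opt _).2).1 _ hopt
        have hold : ∀ x ∈ (Γ.pathState W s σ i).1, x ≠ Γ.terminal (σ i) :=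
          fun x hx he => hnew (he ▸ hx)
        refine ⟨Function.update f (Γ.terminal (σ i)) (Γ.candidatePath W σ i), ⟨?_, ?_⟩, ?_⟩
        · intro x hx
          rcases Finset.mem_insert.1 hx with rfl | hx
          · rwa [Function.update_self]
          · rw [Function.update_of_ne (hold x hx)]
            exact hf.1 x hx
        · intro x hx y hy hne
          rcases Finset.mem_insert.1 hx with rfl | hx <;>
          rcases Finset.mem_insert.1 hy with rfl | hy
          · exact absurd rfl hne
          · rw [Function.update_self, Function.update_of_ne (hold y hy)]
            exact (hdisj _ (hf' y hy)).symm
          · rw [Function.update_self, Function.update_of_ne (hold x hx)]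
            exact hdisj _ (hf' x hx)
          · rw [Function.update_of_ne (hold x hx), Function.update_of_ne (hold y hy)]
            exact hf.2 x hx y hy hne
        · intro x hx
          rcases Finset.mem_insert.1 hx with rfl | hx
          · rw [Function.update_self]
            exact Finset.mem_insert_self _ _
          · rw [Function.update_of_ne (hold x hx)]
            exact Finset.mem_insert_of_mem (hf' x hx)
    · rw [pathState_succ_of_not_accepts hacc]
      refine ⟨fun r hr => ?_, fun P hP => ?_, f, hf, hf'⟩
      · obtain ⟨j, hj, hji, rfl⟩ := h1 r hr
        exact ⟨j, hj, by omega, rfl⟩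
      · obtain ⟨j, hj, hji, hjo, rfl⟩ := h2 P hP
        exact ⟨j, hj, by omega, hjo, rfl⟩

theorem pathState_fst_mono (hij : i ≤ j) (hj : j ≤ n) :
    (Γ.pathState W s σ i).1 ⊆ (Γ.pathState W s σ j).1 := by
  induction j, hij using Nat.le_induction with
  | base => exact subset_rfl
  | succ j hij ih =>
    refine (ih (by omega)).trans ?_
    obtain ⟨j, rfl⟩ : ∃ k : Fin n, (k : ℕ) = j := ⟨⟨j, hj⟩, rfl⟩
    by_cases hacc : Γ.Accepts W s σ j
    · rw [pathState_succ_of_accepts hacc]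
      exact Finset.subset_insert _ _
    · rw [pathState_succ_of_not_accepts hacc]

omit [DecidableEq V] in
theorem card_filter_le_exchangeability [Fintype V] {X : Finset V} (hX : Γ.Indep X) {r : V}
    (hr : r ∈ Γ.ground) (hrX : r ∉ X) {Q : List V} (hQ : IsPathTo Γ.G Γ.S r Q)
    [DecidablePred fun x => ¬ (W.paths Γ.G Γ.S X x).Disjoint Q] :
    (X.filter fun x => ¬ (W.paths Γ.G Γ.S X x).Disjoint Q).card ≤ Γ.exchangeability W := by
  -- The supremum of an unbounded set of naturals is 0, hence the explicit bound.
  refine le_csSup ⟨Fintype.card V, ?_⟩ ⟨X, hX, r, hr, hrX, Q, hQ, by congr⟩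
  rintro m ⟨X, -, r, -, -, Q, -, rfl⟩
  exact Finset.card_le_univ _

theorem hasForbiddenSets_pathAlgorithm [Fintype V] (Γ : OrderedGammoid V n) (W : WitnessRule V)
    (p : unitInterval) :
    Γ.HasForbiddenSets (Γ.pathAlgorithm W p) (Γ.exchangeability W) := by
  classical
  refine ⟨?_, ?_, ?_⟩
  · intro s _ σ
    obtain ⟨h1, -, f, hf, -⟩ := pathState_invariant (Γ := Γ) (W := W) (s := s) (σ := σ) le_rfl
    refine ⟨fun r hr => ?_, f, hf⟩
    obtain ⟨j, -, -, rfl⟩ := h1 r hr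
    exact Γ.terminal_mem_ground _
  · intro s _ σ j hj hmem
    obtain ⟨h1, -⟩ := pathState_invariant (Γ := Γ) (W := W) (s := s) (σ := σ) le_rfl
    obtain ⟨k, hk, -, he⟩ := h1 _ hmem
    have := σ.injective (Γ.terminal.injective he)
    subst this
    omega
  -- Since `r ∉ X`, the witness path of `r` leads to a terminal outside OPT(X), as the
  -- exchangeability requires.
  · refine ⟨fun X Y r => (Γ.opt X).filter fun x => ¬ (W.paths Γ.G Γ.S (Γ.opt X) x).Disjoint
      (W.paths Γ.G Γ.S (Γ.opt Y) r), ?_, ?_⟩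
    · intro Y hY r hr X hX
      refine ⟨(Finset.filter_subset _ _).trans (Γ.opt_subset X), ?_⟩
      refine card_filter_le_exchangeability (Γ.indep_opt X) (hY (Γ.opt_subset Y hr))
        (fun h => ?_) ((W.isLinking _ _ _ (Γ.indep_opt Y).2).1 r hr)
      exact Finset.notMem_erase r Y (hX (Γ.opt_subset X h))
    · intro s _ σ t hst hopt havoid
      have hacc : Γ.Accepts W s σ t := by
        refine ⟨hst, hopt, fun P hP => ?_⟩
        obtain ⟨-, h2, -⟩ := pathState_invariant (Γ := Γ) (W := W) (s := s) (σ := σ) t.isLt.le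
        obtain ⟨j, hj, hjt, hjo, rfl⟩ := h2 P hP
        by_contra hnd
        exact havoid j hj hjt (Finset.mem_filter.2 ⟨hjo, hnd⟩)
      refine pathState_fst_mono (i := t + 1) t.isLt le_rfl ?_
      rw [pathState_succ_of_accepts hacc]
      exact Finset.mem_insert_self _ _

theorem SameUpTo.pathState_eq (hi : i ≤ n) (h : Γ.SameUpTo Γ' σ σ' i) :
    Γ.pathState W s σ i = Γ'.pathState W s σ' i := by
  induction i with
  | zero => rfl
  | succ i ih =>
    have hst := ih (by omega) (h.mono (by omega))
    obtain ⟨i, rfl⟩ : ∃ k : Fin n, (k : ℕ) = i := ⟨⟨i, hi⟩, rfl⟩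
    have hterm : Γ.terminal (σ i) = Γ'.terminal (σ' i) := h.1 i (by omega)
    have hopt := h.opt_eq
    -- Canonical paths are local only at members of the linked set; otherwise both instances reject.
    by_cases hmem : Γ.terminal (σ i) ∈ Γ.opt (Γ.arrived σ (i + 1))
    · have hpath : Γ.candidatePath W σ i = Γ'.candidatePath W σ' i := by
        unfold candidatePath
        rw [W.locality _ _ _ _ _ (h.2.2.mono (Γ.opt_subset _)) _ hmem, hopt, hterm]
      have hiff : Γ.Accepts W s σ i ↔ Γ'.Accepts W s σ' i := by
        unfold Accepts
        rw [hpath, hopt, hterm, hst]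
      by_cases hacc : Γ.Accepts W s σ i
      · rw [pathState_succ_of_accepts hacc, pathState_succ_of_accepts (hiff.1 hacc), hst, hterm,
          hpath]
      · rw [pathState_succ_of_not_accepts hacc,
          pathState_succ_of_not_accepts (mt hiff.2 hacc), hst]
    · have hmem' := hmem
      rw [hopt, hterm] at hmem'
      rw [pathState_succ_of_not_accepts fun h => hmem h.2.1,
        pathState_succ_of_not_accepts fun h => hmem' h.2.1, hst]

end OrderedGammoid

/-! ### Counting favorable arrival orders -/

theorem card_perm_eq_fiber {n : ℕ} (a b : Fin n) :
    n * (Finset.univ.filter fun σ : Equiv.Perm (Fin n) => σ a = b).card = n.factorial := by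
  have h : ∀ c ∈ (Finset.univ : Finset (Fin n)),
      (Finset.univ.filter fun σ : Equiv.Perm (Fin n) => σ a = c).card =
      (Finset.univ.filter fun σ : Equiv.Perm (Fin n) => σ a = b).card := by
    intro c _
    refine Finset.card_bij' (fun σ _ => Equiv.swap b c * σ) (fun σ _ => Equiv.swap b c * σ)
      ?_ ?_ ?_ ?_
    · intro σ hσ
      simp_all
    · intro σ hσ
      simp_all
    · intro σ _
      simp [← mul_assoc]
    · intro σ _
      simp [← mul_assoc]
  have hsum := Finset.card_eq_sum_card_fiberwise (s := (Finset.univ : Finset (Equiv.Perm (Fin n))))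
    (t := Finset.univ) (f := fun σ => σ a) (fun _ _ => Finset.mem_coe.2 (Finset.mem_univ _))
  rw [Finset.sum_congr rfl h] at hsum
  simpa [Fintype.card_perm] using hsum.symm

namespace OrderedGammoid

variable {V : Type*} [DecidableEq V] {n : ℕ} {Γ : OrderedGammoid V n}

theorem arrived_mul_swap (σ : Equiv.Perm (Fin n)) {i u : Fin n} {j : ℕ} (hi : (i : ℕ) < j)
    (hu : (u : ℕ) < j) : Γ.arrived (σ * Equiv.swap i u) j = Γ.arrived σ j := by
  have key : ∀ m : Fin n, (m : ℕ) < j → (Equiv.swap i u m : ℕ) < j := by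
    intro m hm
    rw [Equiv.swap_apply_def]
    split_ifs <;> assumption
  ext x
  rw [mem_arrived, mem_arrived]
  constructor
  · rintro ⟨m, hm, rfl⟩
    exact ⟨_, key m hm, rfl⟩
  · rintro ⟨m, hm, rfl⟩
    exact ⟨Equiv.swap i u m, key m hm, by simp⟩

/-- The arrival orders in which `e` arrives at time `t` and no element arriving between the times
`s` and `t` is forbidden for it. -/
def favorable (Γ : OrderedGammoid V n) (F : Finset V → Finset V → V → Finset V) (e : V) (s : ℕ)
    (t : Fin n) : Finset (Equiv.Perm (Fin n)) :=
  Finset.univ.filter fun σ => Γ.terminal (σ t) = e ∧ ∀ j : Fin n, s ≤ (j : ℕ) → j < t →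
    Γ.terminal (σ j) ∉ F (Γ.arrived σ (j + 1)) (Γ.arrived σ (t + 1)) e

variable {F : Finset V → Finset V → V → Finset V} {e : V} {k : ℕ}

theorem mem_favorable {s : ℕ} {t : Fin n} {σ : Equiv.Perm (Fin n)} :
    σ ∈ Γ.favorable F e s t ↔ Γ.terminal (σ t) = e ∧ ∀ j : Fin n, s ≤ (j : ℕ) → j < t →
      Γ.terminal (σ j) ∉ F (Γ.arrived σ (j + 1)) (Γ.arrived σ (t + 1)) e := by
  simp [favorable]

/-- The condition for sample size `u + 1` sees only arrivals after `u` and the arrived sets at those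
times, so permuting the first `u + 1` positions is harmless. -/
theorem mul_swap_mem_favorable {t i u : Fin n} (hut : u < t) (hiu : i ≤ u)
    {σ : Equiv.Perm (Fin n)} (h : σ ∈ Γ.favorable F e (u + 1) t) :
    σ * Equiv.swap i u ∈ Γ.favorable F e (u + 1) t := by
  rw [mem_favorable] at h ⊢
  have fix : ∀ j : Fin n, u < j → Equiv.swap i u j = j := fun j hj =>
    Equiv.swap_apply_of_ne_of_ne (by omega) (by omega)
  rw [Equiv.Perm.mul_apply, fix t hut]
  refine ⟨h.1, fun j hj hjt => ?_⟩
  rw [Equiv.Perm.mul_apply, fix j (by omega), arrived_mul_swap _ (by omega) (by omega),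
    arrived_mul_swap _ (by omega) (by omega)]
  exact h.2 j hj hjt

/-- Double count pairs of an order and a position `i ≤ u` holding a non-forbidden element. Swapping
`i` with `u` gives every position the same count, and each order has at most `k` bad positions. -/
theorem card_favorable_step {t u : Fin n} (hut : u < t)
    (hF : ∀ σ : Equiv.Perm (Fin n), Γ.terminal (σ t) = e →
      (F (Γ.arrived σ (u + 1)) (Γ.arrived σ (t + 1)) e).card ≤ k) :
    (Γ.favorable F e (u + 1) t).card * (u + 1 - k) ≤ (Γ.favorable F e u t).card * (u + 1) := by
  let good : Equiv.Perm (Fin n) → Fin n → Prop := fun σ i =>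
    Γ.terminal (σ i) ∉ F (Γ.arrived σ (u + 1)) (Γ.arrived σ (t + 1)) e
  have hgood : ∀ σ i, i ≤ u → (good (σ * Equiv.swap i u) u ↔ good σ i) := by
    intro σ i hi
    simp only [good]
    rw [arrived_mul_swap _ (by omega) (by omega), arrived_mul_swap _ (by omega) (by omega)]
    simp
  have hfav : Γ.favorable F e u t = (Γ.favorable F e (u + 1) t).filter fun σ => good σ u := by
    ext σ
    rw [Finset.mem_filter, mem_favorable, mem_favorable]
    constructor
    · rintro ⟨h1, h2⟩
      exact ⟨⟨h1, fun j hj hjt => h2 j (by omega) hjt⟩, h2 u le_rfl hut⟩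
    · rintro ⟨⟨h1, h2⟩, h3⟩
      refine ⟨h1, fun j hj hjt => ?_⟩
      rcases hj.eq_or_lt with he | hlt
      · rw [← Fin.ext he]
        exact h3
      · exact h2 j hlt hjt
  have hcount := Finset.sum_card_bipartiteAbove_eq_sum_card_bipartiteBelow good
    (s := Γ.favorable F e (u + 1) t) (t := Finset.Iic u)
  have hright : ∀ i ∈ Finset.Iic u,
      (Finset.bipartiteBelow good (Γ.favorable F e (u + 1) t) i).card =
        (Γ.favorable F e u t).card := by
    intro i hi
    rw [Finset.mem_Iic] at hi
    rw [hfav, Finset.bipartiteBelow]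
    refine Finset.card_bij' (fun σ _ => σ * Equiv.swap i u) (fun σ _ => σ * Equiv.swap i u)
      ?_ ?_ ?_ ?_
    · intro σ hσ
      rw [Finset.mem_filter] at hσ ⊢
      exact ⟨mul_swap_mem_favorable hut hi hσ.1, (hgood σ i hi).2 hσ.2⟩
    · intro σ hσ
      rw [Finset.mem_filter] at hσ ⊢
      refine ⟨mul_swap_mem_favorable hut hi hσ.1, (hgood _ i hi).1 ?_⟩
      simpa [mul_assoc] using hσ.2
    · intro σ _
      simp [mul_assoc]
    · intro σ _
      simp [mul_assoc]
  have hleft : ∀ σ ∈ Γ.favorable F e (u + 1) t,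
      (u : ℕ) + 1 - k ≤ (Finset.bipartiteAbove good (Finset.Iic u) σ).card := by
    intro σ hσ
    have hbad : ((Finset.Iic u).filter fun i => ¬ good σ i).card ≤ k := by
      refine le_trans ?_ (hF σ (mem_favorable.1 hσ).1)
      refine Finset.card_le_card_of_injOn (fun i => Γ.terminal (σ i)) ?_ ?_
      · intro i hi
        simpa [good] using (Finset.mem_filter.1 hi).2
      · exact fun i _ j _ h => σ.injective (Γ.terminal.injective h)
    have := Finset.card_filter_add_card_filter_not (s := Finset.Iic u) (good σ)
    rw [Fin.card_Iic] at this
    have habove : Finset.bipartiteAbove good (Finset.Iic u) σ =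
        (Finset.Iic u).filter (good σ) := by
      ext i
      simp only [Finset.mem_bipartiteAbove, Finset.mem_filter]
    rw [habove]
    omega
  rw [Finset.sum_congr rfl hright, Finset.sum_const, Fin.card_Iic, smul_eq_mul] at hcount
  rw [mul_comm _ ((u : ℕ) + 1), ← hcount, ← smul_eq_mul]
  exact Finset.card_nsmul_le_sum _ _ _ hleft

theorem mul_card_favorable_self {t : Fin n} (he : e ∈ Γ.ground) :
    n * (Γ.favorable F e t t).card = n.factorial := by
  obtain ⟨b, rfl⟩ : ∃ b, Γ.terminal b = e := by simpa [ground] using he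
  rw [← card_perm_eq_fiber t b]
  congr 2
  ext σ
  rw [mem_favorable, Finset.mem_filter]
  simp only [Finset.mem_univ, true_and, EmbeddingLike.apply_eq_iff_eq, and_iff_left_iff_imp]
  intro _ j hj hjt
  omega

theorem sum_card_favorable_le {s : ℕ} {p : Equiv.Perm (Fin n) → Prop} [DecidablePred p]
    (hp : ∀ t : Fin n, s ≤ (t : ℕ) → ∀ σ ∈ Γ.favorable F e s t, p σ) :
    ∑ t ∈ Finset.univ.filter (fun t : Fin n => s ≤ (t : ℕ)), (Γ.favorable F e s t).card ≤
      (Finset.univ.filter p).card := by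
  rw [← Finset.card_biUnion]
  · refine Finset.card_le_card fun σ hσ => ?_
    rw [Finset.mem_biUnion] at hσ
    obtain ⟨t, ht, hσ⟩ := hσ
    simpa using hp t (by simpa using ht) σ hσ
  · intro t _ t' _ hne
    refine Finset.disjoint_left.2 fun σ h h' => hne ?_
    exact σ.injective (Γ.terminal.injective
      ((mem_favorable.1 h).1.trans (mem_favorable.1 h').1.symm))

/-- The fraction of the arrival orders that are favorable for `e` with sample size `s`. -/
noncomputable def favorableFraction (Γ : OrderedGammoid V n)
    (F : Finset V → Finset V → V → Finset V) (e : V) (s : ℕ) : ℝ :=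
  (∑ t ∈ Finset.univ.filter (fun t : Fin n => s ≤ (t : ℕ)),
    ((Γ.favorable F e s t).card : ℝ)) / n.factorial

theorem favorableFraction_nonneg (s : ℕ) : 0 ≤ Γ.favorableFraction F e s := by
  unfold favorableFraction
  positivity

theorem favorableFraction_self : Γ.favorableFraction F e n = 0 := by
  unfold favorableFraction
  rw [Finset.filter_false_of_mem fun t _ => by omega]
  simp

theorem favorableFraction_step (he : e ∈ Γ.ground) {s : ℕ} (hs : s < n)
    (hF : ∀ (σ : Equiv.Perm (Fin n)) (t : Fin n), s < (t : ℕ) → Γ.terminal (σ t) = e →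
      (F (Γ.arrived σ (s + 1)) (Γ.arrived σ (t + 1)) e).card ≤ k) :
    1 / (n : ℝ) + (1 - (k : ℝ) / (s + 1)) * Γ.favorableFraction F e (s + 1) ≤
      Γ.favorableFraction F e s := by
  have hfact : (0 : ℝ) < n.factorial := by exact_mod_cast n.factorial_pos
  have hn : (0 : ℝ) < n := by exact_mod_cast (by omega : 0 < n)
  have hsplit : (Finset.univ.filter fun t : Fin n => s ≤ (t : ℕ)) =
      insert ⟨s, hs⟩ (Finset.univ.filter fun t : Fin n => s + 1 ≤ (t : ℕ)) := by
    ext t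
    simp only [Finset.mem_filter, Finset.mem_univ, true_and, Finset.mem_insert, Fin.ext_iff]
    omega
  have hself : ((Γ.favorable F e s ⟨s, hs⟩).card : ℝ) = n.factorial / n := by
    rw [eq_div_iff hn.ne']
    have := mul_card_favorable_self (Γ := Γ) (F := F) (t := ⟨s, hs⟩) he
    rw [mul_comm]
    exact_mod_cast this
  have hterm : ∀ t ∈ Finset.univ.filter fun t : Fin n => s + 1 ≤ (t : ℕ),
      (1 - (k : ℝ) / (s + 1)) * (Γ.favorable F e (s + 1) t).card ≤
        (Γ.favorable F e s t).card := by
    intro t ht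
    have ht : s < (t : ℕ) := by simpa using ht
    have hstep := card_favorable_step (Γ := Γ) (F := F) (e := e) (k := k) (t := t) (u := ⟨s, hs⟩)
      ht fun σ hσ => hF σ t ht hσ
    have hs1 : (0 : ℝ) < s + 1 := by positivity
    rw [one_sub_div hs1.ne', div_mul_eq_mul_div, div_le_iff₀ hs1]
    -- Truncated subtraction dominates the real one, so the bound survives when `k > s + 1`.
    have hsub : (s : ℝ) + 1 - k ≤ ((s + 1 - k : ℕ) : ℝ) := by
      rw [sub_le_iff_le_add]
      exact_mod_cast (by omega : s + 1 ≤ s + 1 - k + k)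
    calc ((s : ℝ) + 1 - k) * (Γ.favorable F e (s + 1) t).card
        ≤ ((s + 1 - k : ℕ) : ℝ) * (Γ.favorable F e (s + 1) t).card := by gcongr
      _ ≤ (Γ.favorable F e s t).card * ((s : ℝ) + 1) := by
        rw [mul_comm]
        exact_mod_cast hstep
  unfold favorableFraction
  rw [hsplit, Finset.sum_insert (by simp), hself, ← mul_div_assoc, Finset.mul_sum, add_div,
    div_div_cancel_left' hfact.ne', one_div]
  gcongr with t ht
  exact hterm t ht

end OrderedGammoid

/-! ### Bernstein sums and the differential inequality -/

open Polynomial in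
theorem eval_bernsteinPolynomial_nonneg (n ν : ℕ) {x : ℝ} (h0 : 0 ≤ x) (h1 : x ≤ 1) :
    0 ≤ (bernsteinPolynomial ℝ n ν).eval x := by
  have : 0 ≤ 1 - x := by linarith
  simp only [bernsteinPolynomial, eval_mul, eval_natCast, eval_pow, eval_X, eval_sub, eval_one]
  positivity

open Polynomial in
theorem eval_bernsteinPolynomial_succ_succ (m s : ℕ) (x : ℝ) :
    (bernsteinPolynomial ℝ (m + 1) (s + 1)).eval x =
      x * ((m + 1) / (s + 1) * (bernsteinPolynomial ℝ m s).eval x) := by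
  have hc : ((m : ℝ) + 1) * m.choose s = (m + 1).choose (s + 1) * (s + 1) := by
    exact_mod_cast Nat.add_one_mul_choose_eq m s
  have hs : (s : ℝ) + 1 ≠ 0 := by positivity
  simp only [bernsteinPolynomial, eval_mul, eval_natCast, eval_pow, eval_X, eval_sub, eval_one,
    Nat.add_sub_add_right]
  field_simp
  linear_combination (-(x ^ (s + 1) * (1 - x) ^ (m - s))) * hc

/-- The combination of the Bernstein polynomials of degree `n` with coefficients `c`. -/
noncomputable def bernsteinSum (c : ℕ → ℝ) (n : ℕ) : Polynomial ℝ :=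
  ∑ s ∈ Finset.range (n + 1), Polynomial.C (c s) * bernsteinPolynomial ℝ n s

open Polynomial in
theorem eval_bernsteinSum (c : ℕ → ℝ) (n : ℕ) (x : ℝ) : (bernsteinSum c n).eval x =
    ∑ s ∈ Finset.range (n + 1), c s * (bernsteinPolynomial ℝ n s).eval x := by
  simp [bernsteinSum, eval_finsetSum]

open Polynomial in
theorem eval_one_bernsteinSum (c : ℕ → ℝ) (n : ℕ) : (bernsteinSum c n).eval 1 = c n := by
  simp [eval_bernsteinSum, bernsteinPolynomial.eval_at_1]

open Polynomial in
theorem eval_derivative_bernsteinSum (c : ℕ → ℝ) (m : ℕ) (x : ℝ) :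
    (derivative (bernsteinSum c (m + 1))).eval x =
      (m + 1) * ∑ s ∈ Finset.range (m + 1),
        (c (s + 1) - c s) * (bernsteinPolynomial ℝ m s).eval x := by
  have hzero : (bernsteinPolynomial ℝ m (m + 1)).eval x = 0 := by
    rw [bernsteinPolynomial.eq_zero_of_lt ℝ (Nat.lt_succ_self m), eval_zero]
  have hshift : ∑ s ∈ Finset.range (m + 1), c (s + 1) * (bernsteinPolynomial ℝ m (s + 1)).eval x +
      c 0 * (bernsteinPolynomial ℝ m 0).eval x =
      ∑ s ∈ Finset.range (m + 1), c s * (bernsteinPolynomial ℝ m s).eval x := by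
    rw [← Finset.sum_range_succ' (fun s => c s * (bernsteinPolynomial ℝ m s).eval x),
      Finset.sum_range_succ, hzero, mul_zero, add_zero]
  have hder : (derivative (bernsteinSum c (m + 1))).eval x =
      ∑ s ∈ Finset.range (m + 1), c (s + 1) * ((m + 1) * ((bernsteinPolynomial ℝ m s).eval x -
        (bernsteinPolynomial ℝ m (s + 1)).eval x)) -
      (m + 1) * (c 0 * (bernsteinPolynomial ℝ m 0).eval x) := by
    rw [bernsteinSum, derivative_sum, eval_finsetSum, Finset.sum_range_succ']
    simp only [derivative_C_mul, bernsteinPolynomial.derivative_succ,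
      bernsteinPolynomial.derivative_zero, eval_mul, eval_C, eval_sub, eval_natCast, eval_neg,
      Nat.add_sub_cancel]
    push_cast
    ring
  rw [hder]
  simp only [sub_mul, Finset.sum_sub_distrib]
  rw [← hshift, mul_sub, mul_add, ← sub_sub, Finset.mul_sum, Finset.mul_sum,
    ← Finset.sum_sub_distrib]
  congr 1
  exact Finset.sum_congr rfl fun s _ => by ring

open Polynomial in
/-- A recursive lower bound on the coefficients gives a differential inequality. -/
theorem mul_eval_derivative_bernsteinSum_le {c : ℕ → ℝ} {n : ℕ} {κ : ℝ} (hn : 0 < n)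
    (hκ : 0 ≤ κ) (hc : 0 ≤ c 0)
    (hrec : ∀ s < n, 1 / (n : ℝ) + (1 - κ / (s + 1)) * c (s + 1) ≤ c s) {x : ℝ} (h0 : 0 ≤ x)
    (h1 : x ≤ 1) :
    x * (derivative (bernsteinSum c n)).eval x ≤ κ * (bernsteinSum c n).eval x - x := by
  obtain ⟨m, rfl⟩ := Nat.exists_eq_succ_of_ne_zero hn.ne'
  rw [Nat.succ_eq_add_one] at *
  rw [eval_derivative_bernsteinSum, eval_bernsteinSum, Finset.sum_range_succ' _ (m + 1)]
  have hone : ∑ s ∈ Finset.range (m + 1), (bernsteinPolynomial ℝ m s).eval x = 1 := by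
    rw [← eval_finsetSum, bernsteinPolynomial.sum, eval_one]
  -- The coefficient of index 0 has no partner after the index shift; its sign allows dropping it.
  have hc0 : 0 ≤ κ * (c 0 * (bernsteinPolynomial ℝ (m + 1) 0).eval x) :=
    mul_nonneg hκ (mul_nonneg hc (eval_bernsteinPolynomial_nonneg _ _ h0 h1))
  have hm : (0 : ℝ) < m + 1 := by positivity
  have hmain : x * ((m + 1) * ∑ s ∈ Finset.range (m + 1),
      (c (s + 1) - c s) * (bernsteinPolynomial ℝ m s).eval x) ≤
      κ * ∑ s ∈ Finset.range (m + 1), c (s + 1) * (bernsteinPolynomial ℝ (m + 1) (s + 1)).eval x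
        - x * ∑ s ∈ Finset.range (m + 1), (bernsteinPolynomial ℝ m s).eval x := by
    rw [Finset.mul_sum, Finset.mul_sum, Finset.mul_sum, Finset.mul_sum, ← Finset.sum_sub_distrib]
    refine Finset.sum_le_sum fun s hs => ?_
    have hb := eval_bernsteinPolynomial_nonneg m s h0 h1
    have hr := hrec s (Finset.mem_range.1 hs)
    push_cast at hr
    rw [eval_bernsteinPolynomial_succ_succ]
    have hr' : (m + 1 : ℝ) * (c (s + 1) - c s) ≤ κ * (c (s + 1) * ((m + 1) / (s + 1))) - 1 := by
      have := mul_le_mul_of_nonneg_left hr hm.le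
      rw [mul_add, mul_one_div_cancel hm.ne'] at this
      have e : κ * (c (s + 1) * ((m + 1) / (s + 1))) =
        (m + 1) * (κ / (s + 1) * c (s + 1)) := by ring
      rw [e]
      generalize κ / ((s : ℝ) + 1) = a at this ⊢
      linarith
    have := mul_le_mul_of_nonneg_left hr' (mul_nonneg h0 hb)
    linarith
  rw [hone, mul_one] at hmain
  rw [mul_add]
  linarith

/-- With B the Bernstein sum, B/x^k + H is antitone on (0, 1] by the differential inequality, and it
vanishes at 1. -/
theorem bernsteinSum_add_nonneg {c : ℕ → ℝ} {n k : ℕ} (hn : 0 < n) (hc : 0 ≤ c 0)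
    (hcn : c n = 0)
    (hrec : ∀ s < n, 1 / (n : ℝ) + (1 - (k : ℝ) / (s + 1)) * c (s + 1) ≤ c s) {H : ℝ → ℝ}
    (hH : ∀ x > 0, HasDerivAt H (x ^ k)⁻¹ x) (hH1 : H 1 = 0) {x : ℝ} (h0 : 0 < x) (h1 : x ≤ 1) :
    0 ≤ (bernsteinSum c n).eval x + x ^ k * H x := by
  have hder : ∀ y > 0, HasDerivAt (fun y => (bernsteinSum c n).eval y / y ^ k + H y)
      ((((bernsteinSum c n).derivative.eval y) * y ^ k -
        (bernsteinSum c n).eval y * (k * y ^ (k - 1))) / (y ^ k) ^ 2 + (y ^ k)⁻¹) y :=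
    fun y hy => (((bernsteinSum c n).hasDerivAt y).div (hasDerivAt_pow k y)
      (pow_pos hy k).ne').add (hH y hy)
  have hpos : ∀ y ∈ Set.Icc x 1, 0 < y := fun y hy => h0.trans_le hy.1
  have hanti : AntitoneOn (fun y => (bernsteinSum c n).eval y / y ^ k + H y) (Set.Icc x 1) := by
    refine antitoneOn_of_deriv_nonpos (convex_Icc x 1)
      (fun y hy => (hder y (hpos y hy)).continuousAt.continuousWithinAt)
      (fun y hy => (hder y (hpos y (interior_subset hy))).differentiableAt.differentiableWithinAt)
      fun y hy => ?_
    have hyI := interior_subset hy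
    have hy0 := hpos y hyI
    rw [(hder y hy0).deriv]
    have hle := mul_eval_derivative_bernsteinSum_le (c := c) hn (Nat.cast_nonneg k) hc hrec
      hy0.le hyI.2
    have hk : (k : ℝ) * y ^ (k - 1) * y = k * y ^ k := by
      rcases k with _ | k
      · simp
      · rw [Nat.add_sub_cancel, pow_succ]; ring
    have e : (((bernsteinSum c n).derivative.eval y) * y ^ k -
        (bernsteinSum c n).eval y * (k * y ^ (k - 1))) / (y ^ k) ^ 2 + (y ^ k)⁻¹ =
        (y * (bernsteinSum c n).derivative.eval y - k * (bernsteinSum c n).eval y + y) /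
          (y * y ^ k) := by
      have hyk : y ^ k ≠ 0 := (pow_pos hy0 k).ne'
      field_simp
      linear_combination (-(bernsteinSum c n).eval y) * hk
    rw [e]
    exact div_nonpos_of_nonpos_of_nonneg (by linarith) (by positivity)
  have hxle := hanti ⟨le_rfl, h1⟩ ⟨h1, le_rfl⟩ h1
  simp only [eval_one_bernsteinSum, hcn, hH1, zero_div, add_zero] at hxle
  have hxk : 0 < x ^ k := pow_pos h0 k
  have := mul_nonneg hxk.le hxle
  rwa [mul_add, mul_div_cancel₀ _ hxk.ne'] at this

/-- The value -1 says that the integral of y^(-k) from p(k) to 1 equals 1. The primitive is the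
logarithm for k = 1 and a negative power otherwise. -/
theorem exists_primitive_inv_pow {k : ℕ} (hk : 1 ≤ k) : ∃ H : ℝ → ℝ,
    (∀ x > 0, HasDerivAt H (x ^ k)⁻¹ x) ∧ H 1 = 0 ∧ H (samplingProb k) = -1 := by
  rcases hk.eq_or_lt with rfl | hk
  · refine ⟨Real.log, fun x hx => ?_, Real.log_one, ?_⟩
    · simpa using Real.hasDerivAt_log hx.ne'
    · simp [samplingProb]
  · obtain ⟨m, rfl⟩ : ∃ m, k = m + 2 := ⟨k - 2, by omega⟩
    have hm : (m : ℝ) + 1 ≠ 0 := by positivity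
    refine ⟨fun x => (1 - (x ^ (m + 1))⁻¹) / (m + 1), fun x hx => ?_, by simp, ?_⟩
    · have h := (((hasDerivAt_pow (m + 1) x).inv (pow_pos hx _).ne').const_sub 1).div_const
        ((m : ℝ) + 1)
      refine h.congr_deriv ?_
      push_cast
      have := hx.ne'
      field_simp
      ring
    · have hp : samplingProb (m + 2) ^ (m + 1) = ((m : ℝ) + 2)⁻¹ := by
        unfold samplingProb
        rw [if_neg (by omega), ← Real.rpow_natCast, ← Real.rpow_mul (by positivity)]
        push_cast
        rw [show -(1 / ((m : ℝ) + 2 - 1)) * (m + 1) = -1 by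
          rw [show (m : ℝ) + 2 - 1 = m + 1 by ring]; field_simp]
        exact Real.rpow_neg_one _
      simp only [hp, inv_inv]
      field_simp
      ring

theorem samplingProb_pos {k : ℕ} (hk : 1 ≤ k) : 0 < samplingProb k := by
  have : (0 : ℝ) < k := by exact_mod_cast hk
  unfold samplingProb
  split_ifs <;> positivity

theorem samplingProb_pow {k : ℕ} (hk : 1 ≤ k) : samplingProb k ^ k = 1 / ratio k := by
  unfold samplingProb ratio
  split_ifs with h
  · rw [h, pow_one]
  · have h1 : (k : ℝ) - 1 ≠ 0 := by
      rw [sub_ne_zero]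
      exact_mod_cast h
    rw [← Real.rpow_natCast, ← Real.rpow_mul (by positivity), 
      one_div ((k : ℝ) ^ ((k : ℝ) / (k - 1))), ← Real.rpow_neg (by positivity)]
    congr 1
    field_simp

theorem one_le_ratio {k : ℕ} (hk : 1 ≤ k) : 1 ≤ ratio k := by
  have h1 : (1 : ℝ) ≤ k := by exact_mod_cast hk
  unfold ratio
  split_ifs
  · exact Real.one_le_exp zero_le_one
  · exact Real.one_le_rpow h1 (div_nonneg (by linarith) (by linarith))

theorem ratio_of_two_le {k : ℕ} (hk : 2 ≤ k) :
    ratio k = (k : ℝ) ^ ((k : ℝ) / ((k : ℝ) - 1)) := if_neg (by omega)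

/-- Factor out k; the rest, k^(1/(k-1)), is below e because log k < k - 1. -/
theorem ratio_lt {k : ℕ} (hk : 2 ≤ k) : ratio k < Real.exp 1 * k := by
  have h2 : (2 : ℝ) ≤ k := by exact_mod_cast hk
  have hk0 : (0 : ℝ) < k := by linarith
  have hk1 : (0 : ℝ) < k - 1 := by linarith
  rw [ratio_of_two_le hk, show (k : ℝ) / (k - 1) = 1 / (k - 1) + 1 by field_simp; ring,
    Real.rpow_add hk0, Real.rpow_one]
  refine mul_lt_mul_of_pos_right ?_ hk0
  rw [Real.rpow_def_of_pos hk0, Real.exp_lt_exp, mul_one_div, div_lt_one hk1]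
  exact Real.log_lt_sub_one_of_pos hk0 (by linarith)

open MeasureTheory in
theorem integral_binomial (n : ℕ) (p : unitInterval) (f : ℕ → ℝ) :
    ∫ s, f s ∂(ProbabilityTheory.binomial n p) =
      ∑ s ∈ Finset.range (n + 1), f s * (bernsteinPolynomial ℝ n s).eval (p : ℝ) := by
  rw [ProbabilityTheory.binomial_eq_sum_dirac, integral_finsetSum_measure]
  · rw [show Finset.Iic n = Finset.range (n + 1) by ext; simp]
    refine Finset.sum_congr rfl fun s _ => ?_
    rw [integral_smul_measure, integral_dirac,
      ENNReal.toReal_ofReal ProbabilityTheory.binomial_nonneg]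
    simp [bernsteinPolynomial, mul_comm]
  · exact fun s _ => (integrable_dirac (by simp)).smul_measure ENNReal.ofReal_ne_top

/-! ### From forbidden sets to competitiveness -/

namespace OrderedGammoid

variable {V : Type*} [Finite V] [DecidableEq V] {n : ℕ} {Γ : OrderedGammoid V n}

/-- Algorithms with forbidden sets of size at most `μ` and the right sampling probability are
probability-competitive. -/
theorem HasForbiddenSets.isProbabilityCompetitive {A : SamplingAlgorithm V n} {k μ : ℕ}
    (h : Γ.HasForbiddenSets A k) (hμ : 1 ≤ μ) (hk : k ≤ μ)
    (hp : (A.p : ℝ) = samplingProb μ) : Γ.IsProbabilityCompetitive A (ratio μ) := by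
  refine ⟨one_le_ratio hμ, fun e he => ?_⟩
  obtain ⟨F, hF, hsel⟩ := h.forbidden
  have heg : e ∈ Γ.ground := Γ.opt_subset _ he
  have hn : 0 < n := by
    obtain ⟨b, -⟩ : ∃ b, Γ.terminal b = e := by simpa [ground] using heg
    exact b.pos
  have hopt : ∀ (σ : Equiv.Perm (Fin n)) (t : Fin n), Γ.terminal (σ t) = e →
      e ∈ Γ.opt (Γ.arrived σ (t + 1)) := fun σ t hσ =>
    Γ.mem_opt_of_subset arrived_subset_ground he (hσ ▸ terminal_mem_arrived.2 (by omega))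
  have hrec : ∀ s < n, 1 / (n : ℝ) + (1 - (μ : ℝ) / (s + 1)) * Γ.favorableFraction F e (s + 1) ≤
      Γ.favorableFraction F e s := by
    intro s hs
    refine favorableFraction_step heg hs fun σ t hst hσ => le_trans ?_ hk
    refine (hF _ arrived_subset_ground e (hopt σ t hσ) _ ?_).2
    refine Finset.subset_erase.2 ⟨arrived_mono (by omega), fun hmem => ?_⟩
    rw [← hσ, terminal_mem_arrived] at hmem
    omega
  obtain ⟨H, hH, hH1, hHp⟩ := exists_primitive_inv_pow hμ
  have hpos := samplingProb_pos hμ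
  have hle := (samplingProb_mem μ hμ).2
  have hB := bernsteinSum_add_nonneg hn (favorableFraction_nonneg 0) favorableFraction_self hrec
    hH hH1 hpos hle
  rw [hHp, samplingProb_pow hμ, eval_bernsteinSum, mul_neg_one,
    ← sub_eq_add_neg, sub_nonneg] at hB
  rw [probSelected, integral_binomial, hp]
  -- Compare for each sample size: `e` is selected in every favorable order, and orders favorable at
  -- different times are distinct because `e` arrives once.
  refine hB.trans (Finset.sum_le_sum fun s hs => ?_)
  have hs : s ≤ n := by simpa [Nat.lt_succ_iff] using hs
  refine mul_le_mul_of_nonneg_right ?_ (eval_bernsteinPolynomial_nonneg _ _ hpos.le hle)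
  refine div_le_div_of_nonneg_right ?_ (by positivity)
  rw [← Nat.cast_sum, Nat.cast_le]
  refine sum_card_favorable_le fun t hst σ hσ => ?_
  obtain ⟨hσt, hav⟩ := mem_favorable.1 hσ
  have := hsel s hs σ t hst (by rw [hσt]; exact hopt σ t hσt) (by rwa [hσt])
  rwa [hσt] at this

end OrderedGammoid

theorem mainTheorem5 {V : Type*} [Fintype V] [DecidableEq V] (W : WitnessRule V) (n : ℕ) :
    -- forbidden sets of size equal to the exchangeability, for every sampling probability
    (∀ (Γ : OrderedGammoid V n) (p : unitInterval),
      Γ.HasForbiddenSets (Γ.pathAlgorithm W p) (Γ.exchangeability W)) ∧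
    -- competitiveness for every known upper bound on the exchangeability
    (∀ (Γ : OrderedGammoid V n) (μ : ℕ) (hμ : 1 ≤ μ), Γ.exchangeability W ≤ μ →
      Γ.IsProbabilityCompetitive
        (Γ.pathAlgorithm W ⟨samplingProb μ, samplingProb_mem μ hμ⟩) (ratio μ)) ∧
    -- the decisions up to each step depend only on what has been revealed so far
    (∀ (Γ Γ' : OrderedGammoid V n) (σ σ' : Equiv.Perm (Fin n)) (s i : ℕ), i ≤ n →
      Γ.SameUpTo Γ' σ σ' i → Γ.pathState W s σ i = Γ'.pathState W s σ' i) ∧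
    -- the ratio and the comparison with `e μ`
    (∀ μ : ℕ, 2 ≤ μ → ratio μ = (μ : ℝ) ^ ((μ : ℝ) / ((μ : ℝ) - 1)) ∧
      ratio μ < Real.exp 1 * (μ : ℝ)) := by
  refine ⟨fun Γ p => OrderedGammoid.hasForbiddenSets_pathAlgorithm Γ W p, fun Γ μ hμ hle => ?_,
    fun Γ Γ' σ σ' s i hi h => h.pathState_eq hi, fun μ hμ => ⟨ratio_of_two_le hμ, ratio_lt hμ⟩⟩
  exact (OrderedGammoid.hasForbiddenSets_pathAlgorithm Γ W _).isProbabilityCompetitive hμ hle rfl
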